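/- There is an absolute constant $C>0$ such that the following holds. Let $X$ be a set, and let $h:X\to(0,1)$ be a random function drawn from a $4$-wise independent hash family with range $(0,1)$; that is, each $h(x)$ is uniformly distributed on $(0,1)$, and for any at most four distinct points $x\in X$ the values $h(x)$ are mutually independent. Let $e_1,\dots,e_n\in X$ be elements with fixed (non-random) real priorities $w(e_1)>w(e_2)>\dots>w(e_n)$ (so $e_i$ is the element of rank $i$, for instance the $i$-th most frequent element with its frequency as priority); no assumption is made on how the rank order relates to $X$. Put $s_i=h(e_i)$. Consider the learned Treap on the remapped keys: the binary tree whose nodes are the pairs $(s_j,w(e_j))$, $1\le j\le n$, that is a binary search tree with respect to the keys $s_j$ and in which no node has a larger priority than any of its ancestors (almost surely the $s_j$ are distinct, and this tree is then unique). Let the depth of a node be the number of nodes on the path from the root to it, so that the root has depth $1$. Then for every $1\le i\le n$, $$\mathbb{E}[\text{depth of } s_i]\le 1+C\log i .$$ In particular, the expected depth of $s_i$ is $O(\log i)$ for $i\ge 2$, with a constant independent of $n$, $X$, the elements, the priorities and the hash family. -/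

import Mathlib

open MeasureTheory ProbabilityTheory

/-- A binary tree whose nodes carry pairs `(key, priority)`. -/
abbrev PTree : Type := BinaryTree (ℝ × ℝ)

namespace PTree

/-- `a` is the label `(key, priority)` of some node of the tree. -/
def HasNode (a : ℝ × ℝ) : PTree → Prop
  | .nil => False
  | .node b l r => a = b ∨ HasNode a l ∨ HasNode a r

/-- A treap: at every node, the keys of the left subtree are smaller and those of the right
subtree are larger than the key of the node (search order), and no descendant has a larger
priority (heap order). -/
def IsTreap : PTree → Prop
  | .nil => True
  | .node b l r =>
      (∀ a, HasNode a l → a.1 < b.1 ∧ a.2 ≤ b.2) ∧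
      (∀ a, HasNode a r → b.1 < a.1 ∧ a.2 ≤ b.2) ∧
      IsTreap l ∧ IsTreap r

/-- The number of nodes visited by the search for the key `x`. If `x` is a key of a search tree,
this is the depth of its node, the root having depth `1`. -/
noncomputable def depth (x : ℝ) : PTree → ℕ
  | .nil => 0
  | .node b l r => if x = b.1 then 1 else if x < b.1 then depth x l + 1 else depth x r + 1

end PTree

/-- A random function `h : X → (0, 1)`, drawn according to `μ`, is `k`-wise independent: each value
is uniform on `(0, 1)` and the values at any at most `k` distinct points are independent. -/
structure IsKWiseIndependentHash {Ω X : Type*} [MeasurableSpace Ω] (k : ℕ) (μ : Measure Ω)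
    (h : Ω → X → ℝ) : Prop where
  mem_Ioo : ∀ ω x, h ω x ∈ Set.Ioo (0 : ℝ) 1
  measurable : ∀ x, Measurable fun ω => h ω x
  uniform : ∀ x, pdf.IsUniform (fun ω => h ω x) (Set.Ioo (0 : ℝ) 1) μ volume
  indep : ∀ S : Finset X, S.card ≤ k → iIndepFun (fun (x : S) ω => h ω x) μ

/-- `t` is a learned treap for the elements `e 0, e 1, …` with priorities `w`, where each element
`e j` is stored under the remapped key `g (e j)`: it is a treap whose nodes are exactly the
pairs `(g (e j), w (e j))`. -/
def IsLearnedTreap {X : Type*} {n : ℕ} (e : Fin n → X) (w g : X → ℝ) (t : PTree) : Prop :=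
  PTree.IsTreap t ∧ ∀ a, PTree.HasNode a t ↔ ∃ j, a = (g (e j), w (e j))

/-! A node `j` lies on the path to node `i` exactly when no element of larger priority has its key
between `s_j` and `s_i`. The depth is therefore a finite sum of indicators, and only ranks `j ≤ i`
contribute. For `j < i`, an ancestor is a running minimum ("record") of the circular distance from
`s_i` in one of the two directions. Given `s_i`, these distances are uniform and three-wise
independent: one of the four degrees of independence pays for the conditioning, and circular
distances keep the law free of `s_i`. It remains to show that `N` such variables have `O(log N)`
records in expectation, so that each dyadic block of indices `[m, 2m)` must have `O(1)`.

Values below `1/m` contribute at most 1 in expectation. For values in `[v, 2v)`, put `M = m v` and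
cut the index and value ranges into a `G × G` grid. The records descend through at most `2G` boxes.
A box with `c` records satisfies `c ≤ 2 + choose c 3`, so the count is at most `4G` plus the number
of triples of points sharing a box. The `4G` is paid only if none of the first `m` values is below
`v`, which has probability at most `1/M` by Chebyshev; the triples cost `M³/G⁴` in expectation. With
`G` about `M^(4/5)` both terms are about `M^(-1/5)`, which is summable over the scales `M = 2^t`.
The estimates are `card_records_le`, `measureReal_forall_notMem_le` and
`sum_measureReal_isRecord_mem_le`. -/

/-! ### Depth as a count of ancestors -/

namespace PTree

/-- The labels of the nodes on the search path to the key `x`, when `x` is a key of a treap with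
distinct priorities. -/
def ancestors (x : ℝ) (t : PTree) : Set (ℝ × ℝ) :=
  {a | HasNode a t ∧ ∀ b, HasNode b t → b.1 ∈ Set.uIcc a.1 x → b.2 ≤ a.2}

lemma finite_hasNode (t : PTree) : {a | HasNode a t}.Finite := by
  induction t with
  | nil => simp [HasNode]
  | node b l r hl hr =>
    refine ((Set.finite_singleton b).union (hl.union hr)).subset ?_
    intro a ha
    simpa [HasNode] using ha

lemma finite_ancestors (x : ℝ) (t : PTree) : (ancestors x t).Finite :=
  (finite_hasNode t).subset fun _ h => h.1

/-- The root always qualifies. A node of the subtree not containing `x` is separated from `x` by the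
root's key and fails, while in the other subtree the interval to `x` meets no key outside that
subtree, so the criterion there is the recursive one. -/
lemma depth_eq_ncard_ancestors (t : PTree) (ht : IsTreap t)
    (hinj : ∀ a b, HasNode a t → HasNode b t → a.2 = b.2 → a = b)
    (x : ℝ) (hx : ∃ a, HasNode a t ∧ a.1 = x) :
    depth x t = (ancestors x t).ncard := by
  induction t with
  | nil => simp [HasNode] at hx
  | node b l r hl hr =>
    obtain ⟨hL, hR, tl, tr⟩ := ht
    have hb : HasNode b (.node b l r) := Or.inl rfl
    have inl : ∀ {a}, HasNode a l → HasNode a (.node b l r) := fun h => Or.inr (Or.inl h)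
    have inr : ∀ {a}, HasNode a r → HasNode a (.node b l r) := fun h => Or.inr (Or.inr h)
    have hmax : ∀ a, HasNode a (.node b l r) → a.2 ≤ b.2 := by
      rintro a (rfl | h | h)
      exacts [le_rfl, (hL a h).2, (hR a h).2]
    have hbA : ∀ x, b ∈ ancestors x (.node b l r) := fun x => ⟨hb, fun c hc _ => hmax c hc⟩
    -- A qualifying node separated from `x` by the root has priority at least that of the root,
    -- hence is the root by distinctness of priorities.
    have hnot : ∀ a, a ∈ ancestors x (.node b l r) → b.1 ∈ Set.uIcc a.1 x → a = b :=
      fun a ha h => hinj a b ha.1 hb (le_antisymm (hmax a ha.1) (ha.2 b hb h))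
    rcases lt_trichotomy x b.1 with hlt | heq | hgt
    · have hxl : ∃ a, HasNode a l ∧ a.1 = x := by
        obtain ⟨a, (rfl | h | h), rfl⟩ := hx
        · exact absurd hlt (lt_irrefl _)
        · exact ⟨a, h, rfl⟩
        · exact absurd hlt (not_lt.2 (hR a h).1.le)
      have hset : ancestors x (.node b l r) = insert b (ancestors x l) := by
        ext a
        simp only [Set.mem_insert_iff]
        constructor
        · intro ha
          rcases ha.1 with h | h | h
          · exact Or.inl h
          · exact Or.inr ⟨h, fun c hc => ha.2 c (inl hc)⟩
          · exact Or.inl (hnot a ha (Set.mem_uIcc.2 (Or.inr ⟨hlt.le, (hR a h).1.le⟩)))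
        · rintro (rfl | ha)
          · exact hbA x
          · refine ⟨inl ha.1, ?_⟩
            have hlt' : ∀ c : ℝ, c ∈ Set.uIcc a.1 x → c < b.1 := fun c hc =>
              lt_of_le_of_lt hc.2 (max_lt (hL a ha.1).1 hlt)
            rintro c (rfl | h | h) hc
            · exact absurd (hlt' _ hc) (lt_irrefl _)
            · exact ha.2 c h hc
            · exact absurd (hlt' _ hc) (not_lt.2 (hR c h).1.le)
      have hbn : b ∉ ancestors x l := fun h => lt_irrefl _ (hL b h.1).1
      rw [hset, Set.ncard_insert_of_notMem hbn (finite_ancestors x l),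
        ← hl tl (fun a c ha hc => hinj a c (inl ha) (inl hc)) hxl]
      simp [depth, hlt.ne, hlt]
    · have hset : ancestors x (.node b l r) = {b} := by
        ext a
        simp only [Set.mem_singleton_iff]
        constructor
        · intro ha
          exact hnot a ha (heq ▸ Set.right_mem_uIcc)
        · rintro rfl
          exact hbA x
      rw [hset, Set.ncard_singleton]
      simp [depth, heq]
    · have hxl : ∃ a, HasNode a r ∧ a.1 = x := by
        obtain ⟨a, (rfl | h | h), rfl⟩ := hx
        · exact absurd hgt (lt_irrefl _)
        · exact absurd hgt (not_lt.2 (hL a h).1.le)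
        · exact ⟨a, h, rfl⟩
      have hset : ancestors x (.node b l r) = insert b (ancestors x r) := by
        ext a
        simp only [Set.mem_insert_iff]
        constructor
        · intro ha
          rcases ha.1 with h | h | h
          · exact Or.inl h
          · exact Or.inl (hnot a ha (Set.mem_uIcc.2 (Or.inl ⟨(hL a h).1.le, hgt.le⟩)))
          · exact Or.inr ⟨h, fun c hc => ha.2 c (inr hc)⟩
        · rintro (rfl | ha)
          · exact hbA x
          · refine ⟨inr ha.1, ?_⟩
            have hlt' : ∀ c : ℝ, c ∈ Set.uIcc a.1 x → b.1 < c := fun c hc =>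
              lt_of_lt_of_le (lt_min (hR a ha.1).1 hgt) hc.1
            rintro c (rfl | h | h) hc
            · exact absurd (hlt' _ hc) (lt_irrefl _)
            · exact absurd (hlt' _ hc) (not_lt.2 (hL c h).1.le)
            · exact ha.2 c h hc
      have hbn : b ∉ ancestors x r := fun h => lt_irrefl _ (hR b h.1).1
      rw [hset, Set.ncard_insert_of_notMem hbn (finite_ancestors x r),
        ← hr tr (fun a c ha hc => hinj a c (inr ha) (inr hc)) hxl]
      simp [depth, hgt.ne', hgt.le]

end PTree

/-- The event that `e j` is stored at an ancestor of (or at) the node of `e i`. -/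
def IsTreapAncestor {X : Type*} {n : ℕ} (e : Fin n → X) (w g : X → ℝ) (i j : Fin n) : Prop :=
  ∀ k, g (e k) ∈ Set.uIcc (g (e j)) (g (e i)) → w (e k) ≤ w (e j)

open Classical in
lemma IsLearnedTreap.depth_eq {X : Type*} {n : ℕ} {e : Fin n → X} {w g : X → ℝ} {t : PTree}
    (ht : IsLearnedTreap e w g t) (hw : StrictAnti fun j => w (e j)) (i : Fin n) :
    PTree.depth (g (e i)) t
      = (Finset.univ.filter fun j => IsTreapAncestor e w g i j).card := by
  obtain ⟨h1, h2⟩ := ht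
  have hinj : Function.Injective fun j => (g (e j), w (e j)) := fun j k h =>
    hw.injective (Prod.ext_iff.1 h).2
  rw [PTree.depth_eq_ncard_ancestors t h1 _ _ ⟨_, (h2 _).2 ⟨i, rfl⟩, rfl⟩]
  · have : PTree.ancestors (g (e i)) t
        = (fun j => (g (e j), w (e j))) '' {j | IsTreapAncestor e w g i j} := by
      ext a
      constructor
      · rintro ⟨ha, hb⟩
        obtain ⟨j, rfl⟩ := (h2 a).1 ha
        exact ⟨j, fun k hk => hb _ ((h2 _).2 ⟨k, rfl⟩) hk, rfl⟩
      · rintro ⟨j, hj, rfl⟩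
        refine ⟨(h2 _).2 ⟨j, rfl⟩, fun b hb hk => ?_⟩
        obtain ⟨k, rfl⟩ := (h2 b).1 hb
        exact hj k hk
    rw [this, Set.ncard_image_of_injective _ hinj, ← Set.ncard_coe_finset]
    simp
  · intro a b ha hb hab
    obtain ⟨j, rfl⟩ := (h2 a).1 ha
    obtain ⟨k, rfl⟩ := (h2 b).1 hb
    rw [hw.injective hab]

/-! ### Conditioning on one hash value and rotating the circle -/

namespace IsKWiseIndependentHash

variable {Ω X : Type*} [MeasurableSpace Ω] {μ : Measure Ω} {h : Ω → X → ℝ} {k : ℕ}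

lemma measure_preimage (hh : IsKWiseIndependentHash k μ h) (x : X) {A : Set ℝ}
    (hA : MeasurableSet A) :
    μ ((fun ω => h ω x) ⁻¹' A) = volume (Set.Ioo (0 : ℝ) 1 ∩ A) := by
  rw [pdf.IsUniform.measure_preimage (by simp) (by simp) (hh.uniform x) hA]
  simp

/-- If `g u` maps the uniform distribution to the uniform distribution for every `u`, then the
values `g (h q) (h x)`, for at most `k - 1` points `x ≠ q`, are independent and uniform. -/
lemma measure_forall_mem_Ico [IsProbabilityMeasure μ] (hh : IsKWiseIndependentHash k μ h)
    {g : ℝ → ℝ → ℝ} (hg : Measurable (Function.uncurry g))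
    (hunif : ∀ u ∈ Set.Ioo (0 : ℝ) 1, ∀ a b : ℝ, 0 ≤ a → a ≤ b → b ≤ 1 →
      volume (Set.Ioo (0 : ℝ) 1 ∩ g u ⁻¹' Set.Ico a b) = ENNReal.ofReal (b - a))
    {q : X} {S : Finset X} (hq : q ∉ S) (hS : S.card + 1 ≤ k) {a b : ℝ}
    (ha : 0 ≤ a) (hab : a ≤ b) (hb : b ≤ 1) :
    μ.real {ω | ∀ x ∈ S, g (h ω q) (h ω x) ∈ Set.Ico a b} = (b - a) ^ S.card := by
  classical
  have hind := hh.indep (insert q S) (by rw [Finset.card_insert_of_notMem hq]; exact hS)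
  set q' : (insert q S : Finset X) := ⟨q, Finset.mem_insert_self q S⟩ with hq'
  set T : Finset (insert q S : Finset X) := Finset.univ.erase q' with hT
  have hmeas : ∀ x : (insert q S : Finset X), Measurable fun ω => h ω x :=
    fun x => hh.measurable x
  have hproj : Measurable fun v : ({q'} : Finset (insert q S : Finset X)) → ℝ =>
      v ⟨q', Finset.mem_singleton_self q'⟩ := measurable_pi_apply _
  have hUV := (hind.indepFun_finset {q'} T (by simp [hT]) hmeas).comp hproj measurable_id
  set V : Ω → (T → ℝ) := fun ω x => h ω x with hV
  have hVm : Measurable V := measurable_pi_lambda _ fun x => hh.measurable _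
  have hUm : Measurable fun ω => h ω q := hh.measurable q
  have hprod : μ.map (fun ω => (h ω q, V ω)) = (μ.map fun ω => h ω q).prod (μ.map V) :=
    (indepFun_iff_map_prod_eq_prod_map_map hUm.aemeasurable hVm.aemeasurable).1 hUV
  set E : Set (ℝ × (T → ℝ)) := {p | ∀ x : T, g p.1 (p.2 x) ∈ Set.Ico a b} with hE
  have hEm : MeasurableSet E := by
    have : E = ⋂ x : T, (fun p : ℝ × (T → ℝ) => g p.1 (p.2 x)) ⁻¹' Set.Ico a b := by
      ext p; simp [hE]
    rw [this]
    refine MeasurableSet.iInter fun x => ?_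
    have : Measurable fun p : ℝ × (T → ℝ) => g p.1 (p.2 x) :=
      hg.comp (measurable_fst.prodMk ((measurable_pi_apply x).comp measurable_snd))
    exact this measurableSet_Ico
  have hset : {ω | ∀ x ∈ S, g (h ω q) (h ω x) ∈ Set.Ico a b}
      = (fun ω => (h ω q, V ω)) ⁻¹' E := by
    ext ω
    simp only [Set.mem_ofPred_eq, Set.mem_preimage, hE, hV]
    constructor
    · rintro H ⟨⟨x, hx⟩, hxT⟩
      refine H x ((Finset.mem_insert.1 hx).resolve_left ?_)
      rintro rfl
      simp [hT, hq'] at hxT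
    · intro H x hx
      refine H ⟨⟨x, Finset.mem_insert_of_mem hx⟩, ?_⟩
      simp only [hT, hq', Finset.mem_erase, Finset.mem_univ, and_true, ne_eq, Subtype.mk.injEq]
      rintro rfl
      exact hq hx
  have hcard : T.card = S.card := by
    rw [hT, Finset.card_erase_of_mem (Finset.mem_univ _), Finset.card_univ, Fintype.card_coe,
      Finset.card_insert_of_notMem hq, Nat.add_sub_cancel]
  -- Fubini: the slice at `h q = u` has the same measure for every `u` in `(0, 1)`, so integrating
  -- over `u` changes nothing.
  have hslice : ∀ u ∈ Set.Ioo (0 : ℝ) 1,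
      μ.map V (Prod.mk u ⁻¹' E) = ENNReal.ofReal (b - a) ^ S.card := by
    intro u hu
    have hgu : Measurable (g u) := hg.comp measurable_prodMk_left
    have hA : MeasurableSet (g u ⁻¹' Set.Ico a b) := hgu measurableSet_Ico
    rw [Measure.map_apply hVm (measurable_prodMk_left hEm)]
    have : V ⁻¹' (Prod.mk u ⁻¹' E)
        = ⋂ x ∈ T, (fun ω => h ω x) ⁻¹' (g u ⁻¹' Set.Ico a b) := by
      ext ω; simp [hE, hV]
    rw [this, hind.measure_inter_preimage_eq_mul T (sets := fun _ => g u ⁻¹' Set.Ico a b)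
      fun _ _ => hA]
    have hx : ∀ x ∈ T, μ ((fun ω => h ω x) ⁻¹' (g u ⁻¹' Set.Ico a b)) = ENNReal.ofReal (b - a) :=
      fun x _ => (hh.measure_preimage x hA).trans (hunif u hu a b ha hab hb)
    rw [Finset.prod_congr rfl hx, Finset.prod_const, hcard]
  rw [measureReal_def, hset, ← Measure.map_apply (hUm.prodMk hVm) hEm, hprod,
    Measure.prod_apply hEm, lintegral_map (measurable_measure_prodMk_left hEm) hUm,
    lintegral_congr fun ω => hslice _ (hh.mem_Ioo ω q)]
  simp [ENNReal.toReal_pow, sub_nonneg.2 hab]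

end IsKWiseIndependentHash

/-- Rotating the circle `ℝ / ℤ` preserves the uniform distribution. -/
lemma volume_fract_sub_mem_Ico {u : ℝ} (hu : u ∈ Set.Ioo (0 : ℝ) 1) {a b : ℝ} (ha : 0 ≤ a)
    (hab : a ≤ b) (hb : b ≤ 1) :
    volume (Set.Ioo (0 : ℝ) 1 ∩ (fun v => Int.fract (v - u)) ⁻¹' Set.Ico a b)
      = ENNReal.ofReal (b - a) := by
  obtain ⟨hu0, hu1⟩ := hu
  have hge : ∀ v : ℝ, u ≤ v → v < 1 → Int.fract (v - u) = v - u := fun v h1 h2 =>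
    Int.fract_eq_self.2 ⟨by linarith, by linarith⟩
  have hlt : ∀ v : ℝ, v < u → 0 < v → Int.fract (v - u) = v - u + 1 := fun v h1 h2 => by
    rw [← Int.fract_add_one]
    exact Int.fract_eq_self.2 ⟨by linarith, by linarith⟩
  -- The preimage is the arc from `u + a` to `u + b`, cut where it wraps past 1. The wrapped piece
  -- omits the point 0, which is a null set.
  have hset : Set.Ioo (0 : ℝ) 1 ∩ (fun v => Int.fract (v - u)) ⁻¹' Set.Ico a b
      = Set.Ico (u + a) (min (u + b) 1) ∪
        (Set.Ioi 0 ∩ Set.Ico (u + a - 1) (u + b - 1)) := by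
    ext v
    simp only [Set.mem_inter_iff, Set.mem_Ioo, Set.mem_preimage, Set.mem_Ico, Set.mem_union,
      Set.mem_Ioi, lt_min_iff]
    constructor
    · rintro ⟨⟨h0, h1⟩, h2, h3⟩
      rcases le_or_gt u v with hv | hv
      · rw [hge v hv h1] at h2 h3
        exact Or.inl ⟨by linarith, by linarith, h1⟩
      · rw [hlt v hv h0] at h2 h3
        exact Or.inr ⟨h0, by linarith, by linarith⟩
    · rintro (⟨h1, h2, h3⟩ | ⟨h1, h2, h3⟩)
      · rw [hge v (by linarith) h3]
        exact ⟨⟨by linarith, h3⟩, by linarith, by linarith⟩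
      · rw [hlt v (by linarith) h1]
        exact ⟨⟨h1, by linarith⟩, by linarith, by linarith⟩
  have hae : (Set.Ioi (0 : ℝ) ∩ Set.Ico (u + a - 1) (u + b - 1) : Set ℝ)
      =ᵐ[volume] Set.Ico (max 0 (u + a - 1)) (u + b - 1) := by
    have : Set.Ico (max 0 (u + a - 1)) (u + b - 1)
        = Set.Ici (0 : ℝ) ∩ Set.Ico (u + a - 1) (u + b - 1) := by
      ext v; simp [and_assoc]
    rw [this]
    exact Ioi_ae_eq_Ici.inter (ae_eq_refl _)
  have hdisj : Disjoint (Set.Ico (u + a) (min (u + b) 1))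
      (Set.Ioi 0 ∩ Set.Ico (u + a - 1) (u + b - 1)) := by
    rw [Set.disjoint_left]
    rintro v ⟨h1, -⟩ ⟨-, -, h2⟩
    linarith
  rw [hset, measure_union hdisj (measurableSet_Ioi.inter measurableSet_Ico), measure_congr hae,
    Real.volume_Ico, Real.volume_Ico]
  -- The cases are: no wrapping, partial wrapping, complete wrapping. An empty piece has nonpositive
  -- formal length, which `ENNReal.ofReal` sends to 0.
  rcases le_total (u + a) 1 with h1 | h1
  · rw [max_eq_left (by linarith)]
    rcases le_total (u + b) 1 with h2 | h2
    · rw [min_eq_left h2, ENNReal.ofReal_of_nonpos (p := u + b - 1 - 0) (by linarith), add_zero]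
      congr 1; ring
    · rw [min_eq_right h2, ← ENNReal.ofReal_add (by linarith) (by linarith)]
      congr 1; ring
  · rw [max_eq_right (by linarith), min_eq_right (by linarith),
      ENNReal.ofReal_of_nonpos (p := 1 - (u + a)) (by linarith), zero_add]
    congr 1; ring

/-- The reflection `v ↦ 1 - v` preserves the uniform law and turns `v - (1 - u)` into `u - v`. -/
lemma volume_fract_sub_mem_Ico' {u : ℝ} (hu : u ∈ Set.Ioo (0 : ℝ) 1) {a b : ℝ} (ha : 0 ≤ a)
    (hab : a ≤ b) (hb : b ≤ 1) :
    volume (Set.Ioo (0 : ℝ) 1 ∩ (fun v => Int.fract (u - v)) ⁻¹' Set.Ico a b)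
      = ENNReal.ofReal (b - a) := by
  rw [← volume_fract_sub_mem_Ico (u := 1 - u) ⟨by linarith [hu.2], by linarith [hu.1]⟩ ha hab hb,
    ← (Measure.measurePreserving_sub_left volume (1 : ℝ)).measure_preimage
      (measurableSet_Ioo.inter ((by fun_prop : Measurable fun v : ℝ => Int.fract (v - (1 - u)))
        measurableSet_Ico)).nullMeasurableSet]
  congr 1
  ext v
  simp only [Set.mem_inter_iff, Set.mem_Ioo, Set.mem_preimage]
  rw [show 1 - v - (1 - u) = u - v by ring]
  constructor
  · rintro ⟨⟨h1, h2⟩, h3⟩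
    exact ⟨⟨by linarith, by linarith⟩, h3⟩
  · rintro ⟨⟨h1, h2⟩, h3⟩
    exact ⟨⟨by linarith, by linarith⟩, h3⟩

/-! ### Records as a staircase in a grid -/

/-- `y j` is a weak running minimum of the sequence `y`. -/
def IsRecord (y : ℕ → ℝ) (j : ℕ) : Prop := ∀ k < j, y j ≤ y k

/-- A finite set has at most two elements more than it has three-element subsets. -/
lemma Finset.card_le_two_add_choose_three {α : Type*} (s : Finset α) :
    s.card ≤ 2 + (s.powersetCard 3).card := by
  rw [Finset.card_powersetCard]
  induction s.card with
  | zero => simp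
  | succ n ih =>
    rcases Nat.lt_or_ge n 2 with h | h
    · omega
    · have h1 : (n + 1).choose 3 = n.choose 2 + n.choose 3 := Nat.choose_succ_succ n 2
      have h2 : 0 < n.choose 2 := Nat.choose_pos h
      omega

open Classical in
/-- The records with values in `[v, 2v)` form a decreasing staircase, which visits at most `2G` of
the `G × G` boxes into which indices and values are divided; hence their number is controlled by
the number of triples that share a box. -/
lemma card_records_le (y : ℕ → ℝ) {m G q N : ℕ} (hG : 0 < G) (hm : G * q = m) (hm0 : 0 < m)
    {v : ℝ} (hv : 0 < v) :
    ((Finset.Ico m (min (2 * m) N)).filter fun j => IsRecord y j ∧ y j ∈ Set.Ico v (2 * v)).card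
      ≤ (if ∀ k ∈ Finset.range m, y k ∉ Set.Ico 0 v then 4 * G else 0) +
        ∑ p ∈ Finset.range G ×ˢ Finset.range G,
          (((Finset.Ico (m + p.1 * q) (min (m + (p.1 + 1) * q) N)).powersetCard 3).filter
            fun S => ∀ j ∈ S, y j ∈ Set.Ico (v + p.2 * (v / G)) (v + (p.2 + 1) * (v / G))).card := by
  set R := (Finset.Ico m (min (2 * m) N)).filter fun j => IsRecord y j ∧ y j ∈ Set.Ico v (2 * v)
    with hR
  rcases R.eq_empty_or_nonempty with h0 | ⟨j0, hj0⟩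
  · simp [h0]
  have hRmem : ∀ j ∈ R, m ≤ j ∧ j < 2 * m ∧ j < N ∧ IsRecord y j ∧ v ≤ y j ∧ y j < 2 * v := by
    intro j hj
    simpa [hR, and_assoc] using hj
  have hq : 0 < q := Nat.pos_of_ne_zero (by rintro rfl; omega)
  have hGr : (0 : ℝ) < G := by exact_mod_cast hG
  have hvG : 0 < v / G := div_pos hv hGr
  -- A single record of index at least `m` and value at least `v` forces all of the first `m` values
  -- to be at least `v`.
  have hempty : ∀ k ∈ Finset.range m, y k ∉ Set.Ico 0 v := by
    intro k hk h
    obtain ⟨h1, -, -, h2, h3, -⟩ := hRmem j0 hj0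
    have := h2 k (lt_of_lt_of_le (Finset.mem_range.1 hk) h1)
    linarith [h.2]
  rw [if_pos hempty]
  let A : ℕ → ℕ := fun j => (j - m) / q
  let B : ℕ → ℕ := fun j => ⌊(y j - v) / (v / G)⌋₊
  have hA : ∀ j ∈ R, A j < G := fun j hj => by
    obtain ⟨h1, h2, -⟩ := hRmem j hj
    exact (Nat.div_lt_iff_lt_mul hq).2 (by omega)
  have hBnn : ∀ j ∈ R, 0 ≤ (y j - v) / (v / G) := fun j hj => by
    obtain ⟨-, -, -, -, h2, -⟩ := hRmem j hj
    exact div_nonneg (by linarith) hvG.le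
  have hB : ∀ j ∈ R, B j < G := fun j hj => by
    obtain ⟨-, -, -, -, h2, h3⟩ := hRmem j hj
    refine (Nat.floor_lt (hBnn j hj)).2 ((div_lt_iff₀ hvG).2 ?_)
    rw [mul_div_cancel₀ _ hGr.ne']
    linarith
  set V := R.image fun j => (A j, B j) with hV
  have hVG : V.card ≤ 2 * G := by
    -- As the index grows along the records, the column `A` weakly increases and the row `B` weakly
    -- decreases. Two boxes with equal `A + (G - 1 - B)` therefore coincide, and this sum is below
    -- `2 * G`.
    have hinj : Set.InjOn (fun p : ℕ × ℕ => p.1 + (G - 1 - p.2)) V := by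
      have key : ∀ j ∈ R, ∀ j' ∈ R, j ≤ j' →
          A j + (G - 1 - B j) = A j' + (G - 1 - B j') → (A j, B j) = (A j', B j') := by
        intro j hj j' hj' hle heq
        have h1 : A j ≤ A j' := Nat.div_le_div_right (by omega)
        have h2 : B j' ≤ B j := by
          refine Nat.floor_le_floor (div_le_div_of_nonneg_right ?_ hvG.le)
          rcases hle.eq_or_lt with rfl | hlt
          · exact le_rfl
          · linarith [(hRmem j' hj').2.2.2.1 j hlt]
        have h3 := hB j hj
        have h4 := hB j' hj'
        exact Prod.ext (by simp only; omega) (by simp only; omega)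
      rintro p hp p' hp' heq
      obtain ⟨j, hj, rfl⟩ := Finset.mem_image.1 (Finset.mem_coe.1 hp)
      obtain ⟨j', hj', rfl⟩ := Finset.mem_image.1 (Finset.mem_coe.1 hp')
      rcases le_total j j' with hle | hle
      · exact key j hj j' hj' hle heq
      · exact (key j' hj' j hj hle heq.symm).symm
    have := Finset.card_le_card_of_injOn (t := Finset.range (2 * G)) _ (fun p hp => ?_) hinj
    · simpa using this
    · obtain ⟨j, hj, rfl⟩ := Finset.mem_image.1 (Finset.mem_coe.1 hp)
      have := hA j hj
      simp only [Finset.coe_range, Set.mem_Iio]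
      omega
  have hVsub : V ⊆ Finset.range G ×ˢ Finset.range G := by
    intro p hp
    obtain ⟨j, hj, rfl⟩ := Finset.mem_image.1 hp
    simp [hA j hj, hB j hj]
  rw [Finset.card_eq_sum_card_image (fun j => (A j, B j)) R]
  have hfib : ∀ p, ((R.filter fun j => (A j, B j) = p).powersetCard 3).card ≤
      (((Finset.Ico (m + p.1 * q) (min (m + (p.1 + 1) * q) N)).powersetCard 3).filter
        fun S => ∀ j ∈ S,
          y j ∈ Set.Ico (v + p.2 * (v / G)) (v + (p.2 + 1) * (v / G))).card := by
    intro p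
    refine Finset.card_le_card fun S hS => ?_
    rw [Finset.mem_powersetCard] at hS
    rw [Finset.mem_filter, Finset.mem_powersetCard]
    refine ⟨⟨fun j hj => ?_, hS.2⟩, fun j hj => ?_⟩
    · obtain ⟨hjR, rfl⟩ := Finset.mem_filter.1 (hS.1 hj)
      obtain ⟨h1, h2, h3, -⟩ := hRmem j hjR
      have h4 : (j - m) / q * q ≤ j - m := Nat.div_mul_le_self _ _
      have h5 : j - m < ((j - m) / q + 1) * q := by
        rw [← Nat.div_lt_iff_lt_mul hq]; exact Nat.lt_succ_self _
      simp only [Finset.mem_Ico, lt_min_iff, A]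
      omega
    · obtain ⟨hjR, rfl⟩ := Finset.mem_filter.1 (hS.1 hj)
      have h1 := Nat.floor_le (hBnn j hjR)
      have h2 := Nat.lt_floor_add_one ((y j - v) / (v / G))
      rw [le_div_iff₀ hvG] at h1
      rw [div_lt_iff₀ hvG] at h2
      simp only [Set.mem_Ico, B]
      exact ⟨by linarith, by linarith⟩
  calc ∑ p ∈ V, (R.filter fun j => (A j, B j) = p).card
      ≤ ∑ p ∈ V, (2 + ((R.filter fun j => (A j, B j) = p).powersetCard 3).card) :=
        Finset.sum_le_sum fun p _ => Finset.card_le_two_add_choose_three _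
    _ = V.card * 2 + ∑ p ∈ V, ((R.filter fun j => (A j, B j) = p).powersetCard 3).card := by
        rw [Finset.sum_add_distrib, Finset.sum_const, smul_eq_mul]
    _ ≤ 4 * G + _ := add_le_add (by omega)
        ((Finset.sum_le_sum fun p _ => hfib p).trans
          (Finset.sum_le_sum_of_subset hVsub))

/-! ### Expected number of records at one scale -/

/-- The variables `y j`, `j < N`, take values in `[0, 1)` and any three of them behave on intervals
like independent uniform ones. -/
structure IsThreeWiseUniform {Ω : Type*} [MeasurableSpace Ω] (μ : Measure Ω) (y : ℕ → Ω → ℝ)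
    (N : ℕ) : Prop where
  measurable : ∀ j, Measurable (y j)
  mem_Ico : ∀ j ω, y j ω ∈ Set.Ico (0 : ℝ) 1
  measure_forall : ∀ S : Finset ℕ, (∀ j ∈ S, j < N) → S.card ≤ 3 → ∀ a b : ℝ, 0 ≤ a → a ≤ b →
    b ≤ 1 → μ.real {ω | ∀ j ∈ S, y j ω ∈ Set.Ico a b} = (b - a) ^ S.card

lemma integrable_indicator_one {Ω : Type*} [MeasurableSpace Ω] {μ : Measure Ω}
    [IsFiniteMeasure μ] {E : Set Ω} (hE : MeasurableSet E) :
    Integrable (E.indicator fun _ => (1 : ℝ)) μ :=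
  (integrable_const 1).indicator hE

lemma integral_indicator_one' {Ω : Type*} [MeasurableSpace Ω] {μ : Measure Ω} {E : Set Ω}
    (hE : MeasurableSet E) : ∫ ω, E.indicator (fun _ => (1 : ℝ)) ω ∂μ = μ.real E := by
  rw [integral_indicator_const _ hE, smul_eq_mul, mul_one]

namespace IsThreeWiseUniform

variable {Ω : Type*} [MeasurableSpace Ω] {μ : Measure Ω} {y : ℕ → Ω → ℝ} {N : ℕ}

lemma measurableSet_mem_Ico (hy : IsThreeWiseUniform μ y N) (j : ℕ) (a b : ℝ) :
    MeasurableSet {ω | y j ω ∈ Set.Ico a b} :=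
  hy.measurable j measurableSet_Ico

lemma measurableSet_forall (hy : IsThreeWiseUniform μ y N) (S : Finset ℕ) (a b : ℝ) :
    MeasurableSet {ω | ∀ j ∈ S, y j ω ∈ Set.Ico a b} := by
  have : {ω | ∀ j ∈ S, y j ω ∈ Set.Ico a b} = ⋂ j ∈ S, {ω | y j ω ∈ Set.Ico a b} := by
    ext ω; simp
  rw [this]
  exact Finset.measurableSet_biInter _ fun j _ => hy.measurableSet_mem_Ico j a b

lemma measurableSet_isRecord (hy : IsThreeWiseUniform μ y N) (j : ℕ) :
    MeasurableSet {ω | IsRecord (fun k => y k ω) j} := by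
  have : {ω | IsRecord (fun k => y k ω) j} = ⋂ k ∈ Finset.range j, {ω | y j ω ≤ y k ω} := by
    ext ω; simp [IsRecord]
  rw [this]
  exact Finset.measurableSet_biInter _ fun k _ =>
    measurableSet_le (hy.measurable j) (hy.measurable k)

lemma measureReal_mem (hy : IsThreeWiseUniform μ y N) {j : ℕ} (hj : j < N) {v : ℝ}
    (hv : 0 ≤ v) (hv1 : v ≤ 1) : μ.real {ω | y j ω ∈ Set.Ico 0 v} = v := by
  simpa using hy.measure_forall {j} (by simpa using hj) (by simp) 0 v le_rfl hv hv1

lemma measurableSet_forall_notMem (hy : IsThreeWiseUniform μ y N) (m : ℕ) (v : ℝ) :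
    MeasurableSet {ω | ∀ k ∈ Finset.range m, y k ω ∉ Set.Ico 0 v} := by
  have : {ω | ∀ k ∈ Finset.range m, y k ω ∉ Set.Ico 0 v}
      = ⋂ k ∈ Finset.range m, {ω | y k ω ∈ Set.Ico 0 v}ᶜ := by
    ext ω; simp
  rw [this]
  exact Finset.measurableSet_biInter _ fun j _ => (hy.measurableSet_mem_Ico j 0 v).compl

/-- Chebyshev's inequality for the number of values in `[0, v)`. -/
lemma measureReal_forall_notMem_le [IsProbabilityMeasure μ] (hy : IsThreeWiseUniform μ y N)
    {m : ℕ} (hm0 : 0 < m) (hm : m ≤ N) {v : ℝ} (hv : 0 < v) (hv1 : v ≤ 1) :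
    μ.real {ω | ∀ k ∈ Finset.range m, y k ω ∉ Set.Ico 0 v} ≤ 1 / (m * v) := by
  classical
  set F := {ω | ∀ k ∈ Finset.range m, y k ω ∉ Set.Ico 0 v} with hF
  have hFm : MeasurableSet F := hy.measurableSet_forall_notMem m v
  set E : ℕ → Set Ω := fun k => {ω | y k ω ∈ Set.Ico 0 v} with hE
  have hEm : ∀ k, MeasurableSet (E k) := fun k => hy.measurableSet_mem_Ico k 0 v
  set M : ℝ := m * v with hM
  have hMpos : 0 < M := by positivity
  have hpair : ∀ k ∈ Finset.range m, ∀ l ∈ Finset.range m,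
      μ.real (E k ∩ E l) = v ^ 2 + if k = l then v - v ^ 2 else 0 := by
    intro k hk l hl
    have hk' := (Finset.mem_range.1 hk).trans_le hm
    have hl' := (Finset.mem_range.1 hl).trans_le hm
    split_ifs with hkl
    · subst hkl
      rw [Set.inter_self, hy.measureReal_mem hk' hv.le hv1]; ring
    · have := hy.measure_forall {k, l} (by simp [hk', hl'])
        (by rw [Finset.card_pair hkl]; norm_num) 0 v le_rfl hv.le hv1
      rw [Finset.card_pair hkl, sub_zero] at this
      rw [add_zero, ← this]
      congr 1
      ext ω
      simp [hE]
  -- The square of (count − `M`), expanded into indicators so that its mean `M - M * v` needs only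
  -- pair probabilities. It equals `M ^ 2` on `F`.
  let g : Ω → ℝ := fun ω =>
    (∑ k ∈ Finset.range m, ∑ l ∈ Finset.range m, (E k ∩ E l).indicator (fun _ => (1 : ℝ)) ω)
      - 2 * M * (∑ k ∈ Finset.range m, (E k).indicator (fun _ => (1 : ℝ)) ω) + M ^ 2
  have hg : ∀ ω, g ω = ((∑ k ∈ Finset.range m, (E k).indicator (fun _ => (1 : ℝ)) ω) - M) ^ 2 := by
    intro ω
    have : (∑ k ∈ Finset.range m, (E k).indicator (fun _ => (1 : ℝ)) ω) ^ 2
        = ∑ k ∈ Finset.range m, ∑ l ∈ Finset.range m,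
          (E k ∩ E l).indicator (fun _ => (1 : ℝ)) ω := by
      rw [sq, Finset.sum_mul_sum]
      refine Finset.sum_congr rfl fun k _ => Finset.sum_congr rfl fun l _ => ?_
      by_cases hk : ω ∈ E k <;> by_cases hl : ω ∈ E l <;>
        simp [-Set.mem_ofPred_eq, hk, hl]
    simp only [g, ← this]
    ring
  have hi1 : Integrable (fun ω => ∑ k ∈ Finset.range m, ∑ l ∈ Finset.range m,
      (E k ∩ E l).indicator (fun _ => (1 : ℝ)) ω) μ :=
    integrable_finsetSum _ fun k _ => integrable_finsetSum _ fun l _ =>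
      integrable_indicator_one ((hEm k).inter (hEm l))
  have hi2 : Integrable (fun ω => ∑ k ∈ Finset.range m, (E k).indicator (fun _ => (1 : ℝ)) ω) μ :=
    integrable_finsetSum _ fun k _ => integrable_indicator_one (hEm k)
  have hi3 : Integrable (fun ω => (∑ k ∈ Finset.range m, ∑ l ∈ Finset.range m,
      (E k ∩ E l).indicator (fun _ => (1 : ℝ)) ω)
        - 2 * M * (∑ k ∈ Finset.range m, (E k).indicator (fun _ => (1 : ℝ)) ω)) μ :=
    hi1.sub (hi2.const_mul _)
  have hgi : Integrable g μ := hi3.add (integrable_const _)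
  have hint : ∫ ω, g ω ∂μ = M - M * v := by
    have h1 : ∫ ω, (∑ k ∈ Finset.range m, ∑ l ∈ Finset.range m,
        (E k ∩ E l).indicator (fun _ => (1 : ℝ)) ω) ∂μ = M ^ 2 + (M - M * v) := by
      rw [integral_finsetSum _ fun k _ => integrable_finsetSum _ fun l _ =>
        integrable_indicator_one ((hEm k).inter (hEm l))]
      have : ∀ k ∈ Finset.range m, ∫ ω, (∑ l ∈ Finset.range m,
          (E k ∩ E l).indicator (fun _ => (1 : ℝ)) ω) ∂μ = m * v ^ 2 + (v - v ^ 2) := by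
        intro k hk
        rw [integral_finsetSum _ fun l _ => integrable_indicator_one ((hEm k).inter (hEm l)),
          Finset.sum_congr rfl fun l hl =>
            (integral_indicator_one' ((hEm k).inter (hEm l))).trans (hpair k hk l hl),
          Finset.sum_add_distrib, Finset.sum_ite_eq, if_pos hk]
        simp
      rw [Finset.sum_congr rfl this, Finset.sum_const, Finset.card_range, nsmul_eq_mul, hM]
      ring
    have h2 : ∫ ω, (∑ k ∈ Finset.range m, (E k).indicator (fun _ => (1 : ℝ)) ω) ∂μ = M := by
      rw [integral_finsetSum _ fun k _ => integrable_indicator_one (hEm k),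
        Finset.sum_congr rfl fun k hk => (integral_indicator_one' (hEm k)).trans
          (hy.measureReal_mem ((Finset.mem_range.1 hk).trans_le hm) hv.le hv1)]
      simp [hM]
    simp only [g]
    rw [integral_add hi3 (integrable_const _),
      integral_sub hi1 (hi2.const_mul _), integral_const_mul, h1, h2]
    simp
    ring
  have hle : M ^ 2 * μ.real F ≤ ∫ ω, g ω ∂μ := by
    rw [← integral_indicator_one' hFm, ← integral_const_mul]
    refine integral_mono ((integrable_indicator_one hFm).const_mul _) hgi fun ω => ?_
    simp only [hg]
    by_cases hω : ω ∈ F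
    · have : ∑ k ∈ Finset.range m, (E k).indicator (fun _ => (1 : ℝ)) ω = 0 :=
        Finset.sum_eq_zero fun k hk =>
          Set.indicator_of_notMem (show ω ∉ E k from hω k hk) _
      rw [this, Set.indicator_of_mem hω]
      exact le_of_eq (by ring)
    · rw [Set.indicator_of_notMem hω, mul_zero]
      positivity
  rw [hint] at hle
  rw [le_div_iff₀ hMpos]
  have : 0 ≤ M * v := by positivity
  nlinarith

/-- The expected number of records with index in `[m, 2m)` and value in `[v, 2v)`. -/
lemma sum_measureReal_isRecord_mem_le [IsProbabilityMeasure μ] (hy : IsThreeWiseUniform μ y N)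
    {m G q : ℕ} (hG : 0 < G) (hmG : G * q = m) (hm0 : 0 < m) (hm : m ≤ N) {v : ℝ} (hv : 0 < v)
    (hv1 : 2 * v ≤ 1) :
    ∑ j ∈ Finset.Ico m (min (2 * m) N),
        μ.real {ω | IsRecord (fun k => y k ω) j ∧ y j ω ∈ Set.Ico v (2 * v)}
      ≤ 4 * G / (m * v) + (m * v) ^ 3 / G ^ 4 := by
  classical
  have hGr : (0 : ℝ) < G := by exact_mod_cast hG
  have hvG : 0 < v / G := div_pos hv hGr
  set F := {ω | ∀ k ∈ Finset.range m, y k ω ∉ Set.Ico 0 v} with hF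
  have hFm : MeasurableSet F := hy.measurableSet_forall_notMem m v
  set E : ℕ → Set Ω :=
    fun j => {ω | IsRecord (fun k => y k ω) j ∧ y j ω ∈ Set.Ico v (2 * v)} with hE
  have hEm : ∀ j, MeasurableSet (E j) := fun j =>
    (hy.measurableSet_isRecord j).inter (hy.measurableSet_mem_Ico j _ _)
  let bl : ℕ × ℕ → Finset (Finset ℕ) := fun p =>
    (Finset.Ico (m + p.1 * q) (min (m + (p.1 + 1) * q) N)).powersetCard 3
  let H : ℕ × ℕ → Finset ℕ → Set Ω := fun p S =>
    {ω | ∀ j ∈ S, y j ω ∈ Set.Ico (v + p.2 * (v / G)) (v + (p.2 + 1) * (v / G))}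
  have hHm : ∀ p S, MeasurableSet (H p S) := fun p S => hy.measurableSet_forall S _ _
  let P := Finset.range G ×ˢ Finset.range G
  have hHi : ∀ p ∈ P, Integrable (fun ω => ∑ S ∈ bl p, (H p S).indicator (fun _ => (1 : ℝ)) ω) μ :=
    fun p _ => integrable_finsetSum _ fun S _ => integrable_indicator_one (hHm p S)
  have hpt : ∀ ω, ∑ j ∈ Finset.Ico m (min (2 * m) N), (E j).indicator (fun _ => (1 : ℝ)) ω ≤
      4 * G * F.indicator (fun _ => (1 : ℝ)) ω +
        ∑ p ∈ P, ∑ S ∈ bl p, (H p S).indicator (fun _ => (1 : ℝ)) ω := by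
    intro ω
    have := card_records_le (fun k => y k ω) (N := N) hG hmG hm0 hv
    have h' := (Nat.cast_le (α := ℝ)).2 this
    simp only [Finset.card_filter, Nat.cast_add, Nat.cast_sum, Nat.cast_ite, Nat.cast_one,
      Nat.cast_zero, Nat.cast_mul, Nat.cast_ofNat] at h'
    simpa [Set.indicator_apply, E, F, H, bl, P, mul_ite] using h'
  -- A box spans at most `q` indices, hence at most `q ^ 3` triples, each falling into its value
  -- range with probability `(v / G) ^ 3`.
  have hHp : ∀ p ∈ P, ∑ S ∈ bl p, μ.real (H p S) ≤ (q : ℝ) ^ 3 * (v / G) ^ 3 := by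
    intro p hp
    have hp2 : p.2 + 1 ≤ G := by
      have := (Finset.mem_product.1 hp).2
      simpa [Nat.succ_le_iff] using this
    have hp2' : ((p.2 : ℝ) + 1) * (v / G) ≤ v := by
      have : ((p.2 : ℝ) + 1) ≤ G := by exact_mod_cast hp2
      calc ((p.2 : ℝ) + 1) * (v / G) ≤ G * (v / G) := by gcongr
        _ = v := mul_div_cancel₀ _ hGr.ne'
    have hS : ∀ S ∈ bl p, μ.real (H p S) = (v / G) ^ 3 := by
      intro S hS
      obtain ⟨hS1, hS2⟩ := Finset.mem_powersetCard.1 hS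
      have := hy.measure_forall S
        (fun j hj => ((Finset.mem_Ico.1 (hS1 hj)).2).trans_le (min_le_right _ _)) hS2.le
        (v + p.2 * (v / G)) (v + (p.2 + 1) * (v / G)) (by positivity) (by linarith) (by linarith)
      rw [show μ.real (H p S) = _ from this, hS2]
      congr 1; ring
    rw [Finset.sum_congr rfl hS, Finset.sum_const, nsmul_eq_mul]
    gcongr
    rw [Finset.card_powersetCard, Nat.card_Ico]
    have hq : (p.1 + 1) * q = p.1 * q + q := by ring
    exact_mod_cast (Nat.choose_le_pow _ 3).trans (Nat.pow_le_pow_left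
      (show min (m + (p.1 + 1) * q) N - (m + p.1 * q) ≤ q by omega) 3)
  have hmr : (m : ℝ) = G * q := by exact_mod_cast hmG.symm
  calc ∑ j ∈ Finset.Ico m (min (2 * m) N), μ.real (E j)
      = ∫ ω, ∑ j ∈ Finset.Ico m (min (2 * m) N), (E j).indicator (fun _ => (1 : ℝ)) ω ∂μ := by
        rw [integral_finsetSum _ fun j _ => integrable_indicator_one (hEm j)]
        exact Finset.sum_congr rfl fun j _ => (integral_indicator_one' (hEm j)).symm
    _ ≤ ∫ ω, (4 * G * F.indicator (fun _ => (1 : ℝ)) ω +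
        ∑ p ∈ P, ∑ S ∈ bl p, (H p S).indicator (fun _ => (1 : ℝ)) ω) ∂μ :=
        integral_mono (integrable_finsetSum _ fun j _ => integrable_indicator_one (hEm j))
          (((integrable_indicator_one hFm).const_mul _).add (integrable_finsetSum _ hHi)) hpt
    _ = 4 * G * μ.real F + ∑ p ∈ P, ∑ S ∈ bl p, μ.real (H p S) := by
        rw [integral_add ((integrable_indicator_one hFm).const_mul _)
          (integrable_finsetSum _ hHi), integral_const_mul, integral_indicator_one' hFm,
          integral_finsetSum _ hHi]
        congr 1
        refine Finset.sum_congr rfl fun p _ => ?_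
        rw [integral_finsetSum _ fun S _ => integrable_indicator_one (hHm p S)]
        exact Finset.sum_congr rfl fun S _ => integral_indicator_one' (hHm p S)
    _ ≤ 4 * G * (1 / (m * v)) + ∑ _p ∈ P, (q : ℝ) ^ 3 * (v / G) ^ 3 := by
        gcongr with p hp
        · exact hy.measureReal_forall_notMem_le hm0 hm hv (by linarith)
        · exact hHp p hp
    _ = 4 * G / (m * v) + (m * v) ^ 3 / G ^ 4 := by
        rw [Finset.sum_const, nsmul_eq_mul, Finset.card_product, Finset.card_range, hmr]
        push_cast
        field_simp

end IsThreeWiseUniform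

/-! ### Summation over scales and dyadic blocks -/

/-- Each exponent occurs at most five times, and the geometric series sums to 2. -/
lemma sum_range_half_pow_div_five_le (k : ℕ) :
    ∑ t ∈ Finset.range k, (1 / 2 : ℝ) ^ (t / 5) ≤ 10 := by
  have h5 : ∀ n : ℕ, ∑ t ∈ Finset.range (5 * n), (1 / 2 : ℝ) ^ (t / 5) = 10 - 10 * (1 / 2) ^ n := by
    intro n
    induction n with
    | zero => simp
    | succ n ih =>
      rw [show 5 * (n + 1) = 5 * n + 5 by ring, Finset.sum_range_add, ih,
        Finset.sum_congr rfl fun t ht => by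
          rw [show (5 * n + t) / 5 = n by have := Finset.mem_range.1 ht; omega],
        Finset.sum_const, Finset.card_range, pow_succ]
      simp only [nsmul_eq_mul]
      push_cast
      ring
  calc ∑ t ∈ Finset.range k, (1 / 2 : ℝ) ^ (t / 5)
      ≤ ∑ t ∈ Finset.range (5 * k), (1 / 2 : ℝ) ^ (t / 5) :=
        Finset.sum_le_sum_of_subset_of_nonneg (Finset.range_subset_range.2 (by omega))
          fun _ _ _ => by positivity
    _ ≤ 10 := by
        rw [h5]
        have : (0 : ℝ) ≤ (1 / 2) ^ k := by positivity
        linarith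

namespace IsThreeWiseUniform

variable {Ω : Type*} [MeasurableSpace Ω] {μ : Measure Ω} {y : ℕ → Ω → ℝ} {N : ℕ}

/-- The expected number of records with index in `[2 ^ k, 2 ^ (k + 1))` is bounded. -/
lemma sum_Ico_measureReal_isRecord_le [IsProbabilityMeasure μ] (hy : IsThreeWiseUniform μ y N)
    {k : ℕ} (hk : 2 ^ k ≤ N) :
    ∑ j ∈ Finset.Ico (2 ^ k) (min (2 * 2 ^ k) N), μ.real {ω | IsRecord (fun k => y k ω) j}
      ≤ 51 := by
  set m : ℕ := 2 ^ k with hm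
  have hm0 : 0 < m := by positivity
  have hmr : (m : ℝ) = 2 ^ k := by simp [hm]
  have hmr0 : (0 : ℝ) < m := by exact_mod_cast hm0
  -- The scales double from `1 / m` at `t = 0` to 1 at `t = k`, so that `m * v t = 2 ^ t`.
  let v : ℕ → ℝ := fun t => 2 ^ t / m
  have hv2 : ∀ t, v (t + 1) = 2 * v t := fun t => by simp only [v]; ring
  have hvk : v k = 1 := by simp [v, hmr]
  let E : ℕ → ℕ → Set Ω := fun j t =>
    {ω | IsRecord (fun k => y k ω) j ∧ y j ω ∈ Set.Ico (v t) (2 * v t)}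
  have hsplit : ∀ j ∈ Finset.Ico m (min (2 * m) N), μ.real {ω | IsRecord (fun k => y k ω) j} ≤
      1 / m + ∑ t ∈ Finset.range k, μ.real (E j t) := by
    intro j hj
    have hjN : j < N := (Finset.mem_Ico.1 hj).2.trans_le (min_le_right _ _)
    have hcover : {ω | IsRecord (fun k => y k ω) j} ⊆
        {ω | y j ω ∈ Set.Ico 0 (1 / (m : ℝ))} ∪ ⋃ t ∈ Finset.range k, E j t := by
      intro ω hω
      have hlt : ∀ l, y j ω < v l → ω ∈
          {ω | y j ω ∈ Set.Ico 0 (1 / (m : ℝ))} ∪ ⋃ t ∈ Finset.range l, E j t := by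
        intro l
        induction l with
        | zero => exact fun h => Or.inl ⟨(hy.mem_Ico j ω).1, by simpa [v] using h⟩
        | succ l ih =>
          intro h
          rcases lt_or_ge (y j ω) (v l) with h' | h'
          · rcases ih h' with h1 | h1
            · exact Or.inl h1
            · refine Or.inr (Set.biUnion_subset_biUnion_left ?_ h1)
              exact fun t ht => Finset.mem_range.2 ((Finset.mem_range.1 ht).trans l.lt_succ_self)
          · refine Or.inr (Set.mem_biUnion (Finset.mem_coe.2 (Finset.self_mem_range_succ l)) ?_)
            exact ⟨hω, h', hv2 l ▸ h⟩
      exact hlt k (hvk ▸ (hy.mem_Ico j ω).2)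
    refine (measureReal_mono hcover).trans ((measureReal_union_le _ _).trans ?_)
    refine add_le_add (le_of_eq ?_) (measureReal_biUnion_finset_le _ _)
    refine hy.measureReal_mem hjN (by positivity) ?_
    rw [div_le_one hmr0]
    exact_mod_cast hm0
  have hscale : ∀ t ∈ Finset.range k, ∑ j ∈ Finset.Ico m (min (2 * m) N), μ.real (E j t) ≤
      5 * (1 / 2 : ℝ) ^ (t / 5) := by
    intro t ht
    have htk := Finset.mem_range.1 ht
    -- The grid size `2 ^ (t - r)` is about `(m v)^(4/5)`, which balances `4 G / (m v)` against `(m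
    -- v)^3 / G^4`. Being a power of two below `m`, it divides `m`. The rounding is harmless because
    -- `5 * r ≤ t`.
    set r := t / 5 with hr
    have hrt : 5 * r ≤ t := Nat.mul_div_le t 5
    have hv0 : 0 < v t := by positivity
    have hv1 : 2 * v t ≤ 1 := by
      rw [← hv2, ← hvk]
      simp only [v]
      gcongr
      · norm_num
      · exact htk
    have hG : 2 ^ (t - r) * 2 ^ (k - (t - r)) = m := by
      rw [← pow_add, hm]; congr 1; omega
    refine (hy.sum_measureReal_isRecord_mem_le (by positivity) hG hm0 hk hv0 hv1).trans ?_
    have hmv : (m : ℝ) * v t = 2 ^ t := by simp only [v]; field_simp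
    rw [hmv]
    push_cast
    have h2t : (2 : ℝ) ^ t = 2 ^ (t - r) * 2 ^ r := by rw [← pow_add]; congr 1; omega
    have h1 : 4 * (2 : ℝ) ^ (t - r) / 2 ^ t = 4 * (1 / 2) ^ r := by
      rw [h2t, one_div, inv_pow]; field_simp
    have h2 : ((2 : ℝ) ^ t) ^ 3 / (2 ^ (t - r)) ^ 4 ≤ (1 / 2) ^ r := by
      rw [one_div, inv_pow, ← one_div, div_le_div_iff₀ (by positivity) (by positivity), one_mul,
        ← pow_mul, ← pow_mul, ← pow_add]
      exact pow_le_pow_right₀ (by norm_num) (by omega)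
    linarith
  calc ∑ j ∈ Finset.Ico m (min (2 * m) N), μ.real {ω | IsRecord (fun k => y k ω) j}
      ≤ ∑ j ∈ Finset.Ico m (min (2 * m) N), (1 / m + ∑ t ∈ Finset.range k, μ.real (E j t)) :=
        Finset.sum_le_sum hsplit
    _ = (Finset.Ico m (min (2 * m) N)).card * (1 / m : ℝ) +
        ∑ t ∈ Finset.range k, ∑ j ∈ Finset.Ico m (min (2 * m) N), μ.real (E j t) := by
        rw [Finset.sum_add_distrib, Finset.sum_const, nsmul_eq_mul, Finset.sum_comm]
    _ ≤ m * (1 / m : ℝ) + ∑ t ∈ Finset.range k, 5 * (1 / 2 : ℝ) ^ (t / 5) := by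
        gcongr with t ht
        · rw [Nat.card_Ico]; omega
        · exact hscale t ht
    _ ≤ 51 := by
        rw [← Finset.mul_sum, mul_one_div_cancel hmr0.ne']
        linarith [sum_range_half_pow_div_five_le k]

lemma sum_range_measureReal_isRecord_le [IsProbabilityMeasure μ] (hy : IsThreeWiseUniform μ y N)
    (K : ℕ) :
    ∑ j ∈ Finset.range (min (2 ^ K) N), μ.real {ω | IsRecord (fun k => y k ω) j}
      ≤ 1 + 51 * K := by
  induction K with
  | zero =>
    refine (Finset.sum_le_card_nsmul _ _ 1 fun j _ => measureReal_le_one).trans ?_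
    simp
  | succ K ih =>
    rcases le_or_gt (2 ^ K) N with h | h
    · have hle : min (2 ^ K) N ≤ min (2 ^ (K + 1)) N :=
        min_le_min_right _ (Nat.pow_le_pow_right (by norm_num) K.le_succ)
      rw [← Finset.sum_range_add_sum_Ico _ hle, pow_succ, mul_comm (2 ^ K) 2]
      have := hy.sum_Ico_measureReal_isRecord_le h
      rw [min_eq_left h] at ih ⊢
      push_cast
      linarith
    · rw [min_eq_right h.le] at ih
      rw [min_eq_right (h.le.trans (Nat.pow_le_pow_right (by norm_num) K.le_succ))]
      push_cast
      linarith

/-- The expected number of records is logarithmic. -/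
lemma sum_measureReal_isRecord_le [IsProbabilityMeasure μ] (hy : IsThreeWiseUniform μ y N)
    (hN : 0 < N) :
    ∑ j ∈ Finset.range N, μ.real {ω | IsRecord (fun k => y k ω) j}
      ≤ 103 / Real.log 2 * Real.log (N + 1) := by
  have h := hy.sum_range_measureReal_isRecord_le (Nat.log 2 N + 1)
  rw [min_eq_right (Nat.lt_pow_succ_log_self (by norm_num) N).le] at h
  refine h.trans ?_
  have hlog2 : 0 < Real.log 2 := Real.log_pos (by norm_num)
  have hNr : (1 : ℝ) ≤ N := by exact_mod_cast hN
  have h1 : Real.log 2 ≤ Real.log (N + 1) := Real.log_le_log (by norm_num) (by linarith)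
  have h2 : Nat.log 2 N * Real.log 2 ≤ Real.log (N + 1) := by
    rw [← Real.log_pow]
    refine Real.log_le_log (by positivity) ?_
    have : ((2 ^ Nat.log 2 N : ℕ) : ℝ) ≤ N := by exact_mod_cast Nat.pow_log_le_self 2 hN.ne'
    push_cast at this
    linarith
  -- The bound `52 + 51 log₂ N` is at most `103 log₂ (N + 1)`, since `log₂ (N + 1) ≥ 1`.
  rw [div_mul_eq_mul_div, le_div_iff₀ hlog2]
  push_cast
  nlinarith

end IsThreeWiseUniform

/-! ### From ancestors to records -/

/-- An ancestor of `e i` is a record of the distances from `h (e i)`, measured on the circle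
`ℝ / ℤ` in one of the two directions. -/
lemma IsTreapAncestor.isRecord {X : Type*} {n : ℕ} {e : Fin n → X} {w g : X → ℝ}
    (hg : ∀ x, g x ∈ Set.Ioo (0 : ℝ) 1) (hw : StrictAnti fun j => w (e j)) {i j : Fin n}
    (hj : IsTreapAncestor e w g i j) :
    (∀ k < j, Int.fract (g (e j) - g (e i)) ≤ Int.fract (g (e k) - g (e i))) ∨
      (∀ k < j, Int.fract (g (e i) - g (e j)) ≤ Int.fract (g (e i) - g (e k))) := by
  have hbet : ∀ k < j, g (e k) ∉ Set.uIcc (g (e j)) (g (e i)) := fun k hk h =>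
    absurd (hj k h) (not_le.2 (hw hk))
  obtain ⟨hi0, hi1⟩ := hg (e i)
  obtain ⟨hj0, hj1⟩ := hg (e j)
  have hself : ∀ x : ℝ, 0 ≤ x → x < 1 → Int.fract x = x := fun x h0 h1 =>
    Int.fract_eq_self.2 ⟨h0, h1⟩
  have hadd : ∀ x : ℝ, -1 ≤ x → x < 0 → Int.fract x = x + 1 := fun x h0 h1 => by
    rw [← Int.fract_add_one]
    exact hself _ (by linarith) (by linarith)
  -- The direction is the one that reaches `e j` without wrapping. An earlier key on the same side
  -- must lie beyond `e j`; one on the other side is reached only after wrapping, hence also later.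
  rcases le_total (g (e i)) (g (e j)) with hle | hle
  · left
    intro k hk
    obtain ⟨hk0, hk1⟩ := hg (e k)
    have hk' := hbet k hk
    rw [Set.uIcc_of_ge hle, Set.mem_Icc, not_and, not_le] at hk'
    rw [hself (g (e j) - g (e i)) (by linarith) (by linarith)]
    rcases le_or_gt (g (e i)) (g (e k)) with h | h
    · rw [hself _ (by linarith) (by linarith)]
      linarith [hk' h]
    · rw [hadd _ (by linarith) (by linarith)]
      linarith
  · right
    intro k hk
    obtain ⟨hk0, hk1⟩ := hg (e k)
    have hk' := hbet k hk
    rw [Set.uIcc_of_le hle, Set.mem_Icc, not_and', not_le] at hk'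
    rw [hself (g (e i) - g (e j)) (by linarith) (by linarith)]
    rcases le_or_gt (g (e k)) (g (e i)) with h | h
    · rw [hself _ (by linarith) (by linarith)]
      linarith [hk' h]
    · rw [hadd _ (by linarith) (by linarith)]
      linarith

section

variable {Ω X : Type*} [MeasurableSpace Ω] {μ : Measure Ω} {h : Ω → X → ℝ} {n : ℕ}

/-- The elements `e 0, …, e (n - 1)`, continued by the constant `e i`. -/
def extendRank (e : Fin n → X) (i : Fin n) (j : ℕ) : X := if hj : j < n then e ⟨j, hj⟩ else e i

lemma extendRank_val (e : Fin n → X) (i j : Fin n) : extendRank e i j = e j := by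
  simp [extendRank]

/-- At most three elements of rank below `i`, together with `e i`, are at most four distinct points.
The range stops at `i` because the distance from `e i` to itself is not random. -/
lemma IsKWiseIndependentHash.isThreeWiseUniform [IsProbabilityMeasure μ]
    (hh : IsKWiseIndependentHash 4 μ h) {e : Fin n → X} (he : Function.Injective e) (i : Fin n)
    {g : ℝ → ℝ → ℝ} (hg : Measurable (Function.uncurry g))
    (hmem : ∀ u v, g u v ∈ Set.Ico (0 : ℝ) 1)
    (hunif : ∀ u ∈ Set.Ioo (0 : ℝ) 1, ∀ a b : ℝ, 0 ≤ a → a ≤ b → b ≤ 1 →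
      volume (Set.Ioo (0 : ℝ) 1 ∩ g u ⁻¹' Set.Ico a b) = ENNReal.ofReal (b - a)) :
    IsThreeWiseUniform μ (fun j ω => g (h ω (e i)) (h ω (extendRank e i j))) i where
  measurable j := hg.comp ((hh.measurable _).prodMk (hh.measurable _))
  mem_Ico j ω := hmem _ _
  measure_forall S hS hcard a b ha hab hb := by
    classical
    have hval : ∀ j (hj : j < (i : ℕ)), extendRank e i j = e ⟨j, hj.trans i.2⟩ := fun j hj =>
      extendRank_val e i ⟨j, hj.trans i.2⟩
    have hinj : Set.InjOn (extendRank e i) S := by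
      intro j hj k hk hjk
      rw [hval j (hS j hj), hval k (hS k hk)] at hjk
      exact Fin.mk.inj_iff.1 (he hjk)
    have hnot : e i ∉ S.image (extendRank e i) := by
      intro hmem
      obtain ⟨j, hj, hji⟩ := Finset.mem_image.1 hmem
      rw [hval j (hS j hj)] at hji
      have := hS j hj
      rw [← he hji] at this
      exact lt_irrefl _ this
    have := hh.measure_forall_mem_Ico hg hunif hnot
      (by rw [Finset.card_image_of_injOn hinj]; omega) ha hab hb
    rw [Finset.card_image_of_injOn hinj] at this
    rw [← this]
    congr 1
    ext ω
    simp

lemma measurableSet_isTreapAncestor (hh : ∀ x, Measurable fun ω => h ω x) (e : Fin n → X)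
    (w : X → ℝ) (i j : Fin n) : MeasurableSet {ω | IsTreapAncestor e w (h ω) i j} := by
  have : {ω | IsTreapAncestor e w (h ω) i j} = ⋂ k : Fin n,
      ({ω | min (h ω (e j)) (h ω (e i)) ≤ h ω (e k)} ∩
        {ω | h ω (e k) ≤ max (h ω (e j)) (h ω (e i))})ᶜ ∪ {_ω | w (e k) ≤ w (e j)} := by
    ext ω
    simp only [IsTreapAncestor, Set.uIcc, Set.mem_Icc, Set.mem_iInter, Set.mem_union,
      Set.mem_compl_iff, Set.mem_inter_iff, Set.mem_ofPred_eq, imp_iff_not_or]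
  rw [this]
  refine MeasurableSet.iInter fun k => ((MeasurableSet.inter ?_ ?_).compl).union (.const _)
  · exact measurableSet_le ((hh _).min (hh _)) (hh _)
  · exact measurableSet_le (hh _) ((hh _).max (hh _))

/-- The expected number of ancestors of the element of rank `i` is logarithmic in `i`. -/
lemma IsKWiseIndependentHash.sum_measureReal_isTreapAncestor_le [IsProbabilityMeasure μ]
    (hh : IsKWiseIndependentHash 4 μ h) {e : Fin n → X} {w : X → ℝ}
    (hw : StrictAnti fun j => w (e j)) (i : Fin n) :
    ∑ j, μ.real {ω | IsTreapAncestor e w (h ω) i j}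
      ≤ 1 + 206 / Real.log 2 * Real.log ((i : ℕ) + 1) := by
  have he : Function.Injective e := fun j k hjk => hw.injective (congrArg w hjk)
  set y₁ : ℕ → Ω → ℝ := fun j ω => Int.fract (h ω (extendRank e i j) - h ω (e i)) with hy₁
  set y₂ : ℕ → Ω → ℝ := fun j ω => Int.fract (h ω (e i) - h ω (extendRank e i j)) with hy₂
  have h₁ : IsThreeWiseUniform μ y₁ i :=
    hh.isThreeWiseUniform he i (g := fun u v => Int.fract (v - u))
      (measurable_fract.comp (measurable_snd.sub measurable_fst))
      (fun u v => ⟨Int.fract_nonneg _, Int.fract_lt_one _⟩)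
      fun u hu a b => volume_fract_sub_mem_Ico hu
  have h₂ : IsThreeWiseUniform μ y₂ i :=
    hh.isThreeWiseUniform he i (g := fun u v => Int.fract (u - v))
      (measurable_fract.comp (measurable_fst.sub measurable_snd))
      (fun u v => ⟨Int.fract_nonneg _, Int.fract_lt_one _⟩)
      fun u hu a b => volume_fract_sub_mem_Ico' hu
  set r₁ : ℕ → ℝ := fun j => μ.real {ω | IsRecord (fun k => y₁ k ω) j} with hr₁
  set r₂ : ℕ → ℝ := fun j => μ.real {ω | IsRecord (fun k => y₂ k ω) j} with hr₂
  -- Ranks before `i` pay for a record in either direction and `i` itself pays 1. Later ranks pay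
  -- nothing, since `e i` lies in the interval and has larger priority.
  set F : ℕ → ℝ := fun j =>
    if j < (i : ℕ) then r₁ j + r₂ j else if j = (i : ℕ) then 1 else 0 with hF
  have hle : ∀ j : Fin n, μ.real {ω | IsTreapAncestor e w (h ω) i j} ≤ F j := by
    intro j
    rcases lt_trichotomy j i with hji | rfl | hji
    · rw [hF]
      simp only [Fin.val_fin_lt, hji, if_true]
      refine le_trans (measureReal_mono ?_) (measureReal_union_le _ _)
      intro ω hω
      have hval : ∀ k < (j : ℕ), ∃ k' : Fin n, k' < j ∧ extendRank e i k = e k' := fun k hk =>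
        ⟨⟨k, hk.trans j.2⟩, hk, extendRank_val e i ⟨k, hk.trans j.2⟩⟩
      refine (IsTreapAncestor.isRecord (hh.mem_Ioo ω) hw hω).imp (fun H k hk => ?_)
        (fun H k hk => ?_)
      · obtain ⟨k', hk', hkk⟩ := hval k hk
        simpa [y₁, extendRank_val, hkk] using H k' hk'
      · obtain ⟨k', hk', hkk⟩ := hval k hk
        simpa [y₂, extendRank_val, hkk] using H k' hk'
    · simp [hF]
    · have : {ω | IsTreapAncestor e w (h ω) i j} = ∅ :=
        Set.eq_empty_of_forall_notMem fun ω hω =>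
          absurd (hω i Set.right_mem_uIcc) (not_le.2 (hw hji))
      rw [this, measureReal_empty, hF]
      have h1 : ¬ (j : ℕ) < i := not_lt.2 (le_of_lt hji)
      have h2 : (j : ℕ) ≠ i := ne_of_gt hji
      simp [h1, h2]
  have hsum : ∑ j : Fin n, F j = 1 + (∑ j ∈ Finset.range i, r₁ j + ∑ j ∈ Finset.range i, r₂ j) := by
    rw [Fin.sum_univ_eq_sum_range F n, ← Finset.sum_subset
      (Finset.range_subset_range.2 (Nat.succ_le_of_lt i.2)), Finset.sum_range_succ,
      ← Finset.sum_add_distrib, add_comm]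
    · congr 1
      · simp [hF]
      · exact Finset.sum_congr rfl fun j hj => by simp [hF, Finset.mem_range.1 hj]
    · intro j _ hj
      rw [Finset.mem_range] at hj
      have h1 : ¬ j < (i : ℕ) := by omega
      have h2 : j ≠ (i : ℕ) := by omega
      simp [hF, h1, h2]
  refine (Finset.sum_le_sum fun j _ => hle j).trans ?_
  rw [hsum]
  rcases Nat.eq_zero_or_pos (i : ℕ) with h0 | hpos
  · simp [h0]
  · have e₁ := h₁.sum_measureReal_isRecord_le hpos
    have e₂ := h₂.sum_measureReal_isRecord_le hpos
    have : 206 / Real.log 2 * Real.log ((i : ℕ) + 1)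
        = 103 / Real.log 2 * Real.log ((i : ℕ) + 1) + 103 / Real.log 2 * Real.log ((i : ℕ) + 1) := by
      ring
    linarith

end

theorem mainTheorem9 :
    ∃ C : ℝ, 0 < C ∧
      ∀ {X Ω : Type*} [MeasurableSpace Ω] (μ : Measure Ω) [IsProbabilityMeasure μ]
        (h : Ω → X → ℝ), IsKWiseIndependentHash 4 μ h →
      ∀ (n : ℕ) (e : Fin n → X) (w : X → ℝ), StrictAnti (fun j => w (e j)) →
      ∀ T : Ω → PTree, (∀ᵐ ω ∂μ, IsLearnedTreap e w (h ω) (T ω)) →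
      ∀ i : Fin n,
        Integrable (fun ω => (PTree.depth (h ω (e i)) (T ω) : ℝ)) μ ∧
        ∫ ω, (PTree.depth (h ω (e i)) (T ω) : ℝ) ∂μ ≤ 1 + C * Real.log ((i : ℕ) + 1) := by
  classical
  refine ⟨206 / Real.log 2, div_pos (by norm_num) (Real.log_pos (by norm_num)), ?_⟩
  intro X Ω _ μ _ h hh n e w hw T hT i
  have hm : ∀ j, MeasurableSet {ω | IsTreapAncestor e w (h ω) i j} :=
    measurableSet_isTreapAncestor hh.measurable e w i
  have hint : Integrable (fun ω => ∑ j,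
      {ω | IsTreapAncestor e w (h ω) i j}.indicator (fun _ => (1 : ℝ)) ω) μ :=
    integrable_finsetSum _ fun j _ => integrable_indicator_one (hm j)
  -- No measurability of `T` is assumed; integrability of the depth comes from its almost sure
  -- equality with this finite sum of indicators.
  have hae : (fun ω => (PTree.depth (h ω (e i)) (T ω) : ℝ)) =ᵐ[μ] fun ω => ∑ j,
      {ω | IsTreapAncestor e w (h ω) i j}.indicator (fun _ => (1 : ℝ)) ω := by
    filter_upwards [hT] with ω hω
    rw [hω.depth_eq hw i, Finset.card_filter]
    push_cast
    simp [Set.indicator_apply]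
  refine ⟨hint.congr hae.symm, ?_⟩
  rw [integral_congr_ae hae, integral_finsetSum _ fun j _ => integrable_indicator_one (hm j),
    Finset.sum_congr rfl fun j _ => integral_indicator_one' (hm j)]
  exact hh.sum_measureReal_isTreapAncestor_le hw i
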